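/- Let $S$ be a commutative monoid, and let $L_S$ be the first-order language with one unary function symbol for each $s\in S$. An $S$-act is a nonempty $L_S$-structure $A$ with $1a=a$ and $s(ta)=(st)a$ for all $s,t\in S$, $a\in A$; $S$ itself is an $S$-act ${}_SS$ under multiplication. Subacts are subsets closed under the action of $S$. An element $a\in A$ is *act-regular* if there is a homomorphism of $S$-acts $\varphi: Sa\to {}_SS$ with $\varphi(a)a=a$; an $S$-act (or subact) is *regular* if all its elements are act-regular. Let $\mathfrak R$ be the class of all regular $S$-acts, and let $R$ be the union of all regular subacts of ${}_SS$, which is a subsemigroup of $S$. A *primitive formula* is a formula $\exists \bar u(\Phi_0\wedge\dots\wedge\Phi_k)$ with atomic $\Phi_i$. A first-order theory $T$ is *primitive normal* if for every model $M$ of $T$, every primitive formula $\Phi(\bar x,\bar y)$ and all tuples $\bar a,\bar b$ in $M$ with $|\bar a|=|\bar b|=|\bar y|$, the sets $\Phi(M,\bar a)=\{\bar c\mid M\models\Phi(\bar c,\bar a)\}$ and $\Phi(M,\bar b)$ are equal or disjoint. A class of structures is *axiomatizable* if it is the class of all (nonempty) models of some first-order theory; an axiomatizable class is *primitive normal* if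 its theory (the set of all sentences true in all its members) is primitive normal. **Theorem.** Suppose that the class $\mathfrak R$ of regular $S$-acts is axiomatizable. Then $\mathfrak R$ is primitive normal if and only if the semigroup $R$ is linearly ordered, that is, for all $a,b\in R$, $Ra\subseteq Rb$ or $Rb\subseteq Ra$. -/

import Mathlib

open FirstOrder FirstOrder.Language CategoryTheory

universe u v w

/-! ### Primitive formulas and primitive normality -/

/-- Finite nonempty conjunctions of atomic formulas. -/
inductive IsAtomicConj {L : FirstOrder.Language.{u, v}} {α : Type} {k : ℕ} : L.BoundedFormula α k → Prop
  | atomic {φ : L.BoundedFormula α k} (h : φ.IsAtomic) : IsAtomicConj φ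
  | inf {φ ψ : L.BoundedFormula α k} (hφ : IsAtomicConj φ) (hψ : IsAtomicConj ψ) :
      IsAtomicConj (φ ⊓ ψ)

/-- A primitive formula: an existentially quantified (over a finite tuple) conjunction of atomic
formulas. -/
def IsPrimitiveFormula {L : FirstOrder.Language.{u, v}} {α : Type} (Φ : L.Formula α) : Prop :=
  ∃ (k : ℕ) (ψ : L.BoundedFormula α k), IsAtomicConj ψ ∧ Φ = ψ.exs

/-- The set `Φ(M, a)` of all `n`-tuples `b` of elements of `M` such that `M ⊨ Φ(b, a)`. -/
def solutionSet {L : FirstOrder.Language.{u, v}} {M : Type w} [L.Structure M] {n m : ℕ}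
    (Φ : L.Formula (Fin n ⊕ Fin m)) (a : Fin m → M) : Set (Fin n → M) :=
  {b | Φ.Realize (Sum.elim b a)}

/-- A theory is primitive normal if any two primitive copies `Φ(M, a)`, `Φ(M, b)` are equal or
disjoint. Since this is a first-order property, for a complete theory it makes no difference
whether it is asked of one (say, a large saturated) model or of all models; for an arbitrary theory
it is asked of all its models, that is, of all its completions. -/
def IsPrimitiveNormalTheory {L : FirstOrder.Language.{u, v}} (T : L.Theory) : Prop :=
  ∀ (M : Theory.ModelType.{u, v, max u v} T) (n m : ℕ) (Φ : L.Formula (Fin n ⊕ Fin m)),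
    IsPrimitiveFormula Φ → ∀ a b : Fin m → M,
      solutionSet Φ a = solutionSet Φ b ∨ solutionSet Φ a ∩ solutionSet Φ b = ∅

/-- The theory of a class of structures: all sentences true in all structures of the class. -/
def theoryOfClass {L : FirstOrder.Language.{u, v}} (K : Set (Bundled.{w} L.Structure)) : L.Theory :=
  {σ | ∀ M ∈ K, M ⊨ σ}

/-- A class of (nonempty) structures is axiomatizable if it is the class of all (nonempty) models
of some first-order theory. -/
def IsAxiomatizable {L : FirstOrder.Language.{u, v}} (K : Set (Bundled.{w} L.Structure)) : Prop :=
  ∃ T : L.Theory, ∀ M : Bundled.{w} L.Structure, M ∈ K ↔ Nonempty M ∧ M ⊨ T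

/-- A class of structures is primitive normal if its theory is. -/
def IsPrimitiveNormalClass {L : FirstOrder.Language.{u, v}} (K : Set (Bundled.{w} L.Structure)) : Prop :=
  IsPrimitiveNormalTheory (theoryOfClass K)

/-! ### Acts over a monoid -/

/-- The function symbols of the language of `S`-acts: a unary symbol for every `s : S`. -/
inductive ActFunction (S : Type u) : ℕ → Type u
  | act (s : S) : ActFunction S 1

/-- The language `L_S = {s | s ∈ S}` of `S`-acts. -/
def actLanguage (S : Type u) : FirstOrder.Language.{u, 0} where
  Functions := ActFunction S
  Relations := fun _ => Empty

/-- The cyclic subact `Sa`. -/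
def cyclicSubact (S : Type u) [Monoid S] {A : Type w} [MulAction S A] (a : A) :
    SubMulAction S A where
  carrier := {x | ∃ s : S, s • a = x}
  smul_mem' := by
    rintro t _ ⟨s, rfl⟩
    exact ⟨t * s, mul_smul t s a⟩

theorem self_mem_cyclicSubact (S : Type u) [Monoid S] {A : Type w} [MulAction S A] (a : A) :
    a ∈ cyclicSubact S a :=
  ⟨1, one_smul S a⟩

/-- `a` is act-regular if there is a homomorphism of acts `φ : Sa → S` with `φ(a) a = a`. -/
def IsActRegular (S : Type u) [Monoid S] {A : Type w} [MulAction S A] (a : A) : Prop :=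
  ∃ φ : cyclicSubact S a →[S] S, φ ⟨a, self_mem_cyclicSubact S a⟩ • a = a

/-- An act is regular if all its elements are act-regular. -/
def IsRegularAct (S : Type u) [Monoid S] (A : Type w) [MulAction S A] : Prop :=
  ∀ a : A, IsActRegular S a

/-- The class of all (nonempty) regular `S`-acts, as structures of the language `L_S`. -/
def regularActs (S : Type u) [Monoid S] : Set (Bundled.{u} (actLanguage S).Structure) :=
  {A | Nonempty A ∧ ∃ _ : MulAction S A,
    (∀ (s : S) (x : Fin 1 → A),
      Structure.funMap (L := actLanguage S) (ActFunction.act s) x = s • x 0) ∧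
    IsRegularAct S A}

/-- The union `R` of all regular subacts of the `S`-act `S` (with action by left
multiplication). -/
def maxRegularSubact (S : Type u) [Monoid S] : SubMulAction S S where
  carrier := {a | ∃ B : SubMulAction S S, IsRegularAct S B ∧ a ∈ B}
  smul_mem' := by
    rintro t a ⟨B, hB, ha⟩
    exact ⟨B, hB, B.smul_mem t ha⟩

/-- `R` is a subsemigroup of `S`. -/
instance maxRegularSubactSemigroup (S : Type u) [Monoid S] : Semigroup (maxRegularSubact S) where
  mul a b := ⟨(a : S) * (b : S), (maxRegularSubact S).smul_mem (a : S) b.2⟩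
  mul_assoc a b c := Subtype.ext (mul_assoc (a : S) (b : S) (c : S))

/-- A semigroup `T` is linearly ordered if `Ta ⊆ Tb` or `Tb ⊆ Ta` for all `a, b ∈ T`. -/
def IsLinearlyOrderedSemigroup (T : Type u) [Semigroup T] : Prop :=
  ∀ a b : T, Set.range (fun t : T => t * a) ⊆ Set.range (fun t : T => t * b) ∨
    Set.range (fun t : T => t * b) ⊆ Set.range (fun t : T => t * a)

/-! An element `x` is act-regular iff `Sx ≅ Se` for an idempotent `e`, so regularity of `x` depends
only on the congruence `{(s, t) | s • x = t • x}`; in a regular act, `e` can be taken in `R`.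

If `R` is linearly ordered, every regular act carries a Mal'tsev operation commuting with the action
(`maltsev`). It preserves primitive formulas, so two solution sets with a common point coincide.
Axiomatizability ensures that every model of the theory is a regular act.

Conversely, primitive normality of `∃ u, x = a u ∧ y = b u` closes zigzags
(`IsPrimitiveNormalClass.exists_of_zigzag`). In `Se ∪ Sf` this makes idempotents `e`, `f` of `R`
comparable. In three copies of `Se` glued in a chain along `Sb` and `Sa`, it makes `a` and `b`
comparable. -/

/-! ### Regular elements and idempotents -/

section ActRegular

variable {S : Type u} [CommMonoid S]

/-- `e` is an idempotent fixing `x` such that `x ↦ e` induces an isomorphism `Sx ≅ Se`. -/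
structure IsRegularIdempotent {M : Type w} [MulAction S M] (x : M) (e : S) : Prop where
  mul_self : e * e = e
  smul_eq : e • x = x
  cancel : ∀ s t : S, s • x = t • x → s * e = t * e

theorem isActRegular_iff {M : Type w} [MulAction S M] (x : M) :
    IsActRegular S x ↔ ∃ e : S, IsRegularIdempotent x e := by
  constructor
  · rintro ⟨φ, hφ⟩
    set g : cyclicSubact S x := ⟨x, self_mem_cyclicSubact S x⟩
    refine ⟨φ g, ?_, hφ, fun s t h => ?_⟩
    · have h : φ g • g = g := Subtype.ext hφ
      have := map_smul φ (φ g) g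
      rw [h] at this
      exact this.symm
    · have h' : s • g = t • g := Subtype.ext h
      have := congrArg φ h'
      rwa [map_smul, map_smul] at this
  · rintro ⟨e, he⟩
    -- The homomorphism is `s • x ↦ s * e`, independent of the choice of `s` by `cancel`.
    have key (y : cyclicSubact S x) (s : S) (hs : s • x = y) : y.2.choose * e = s * e :=
      he.cancel _ _ (y.2.choose_spec.trans hs.symm)
    refine ⟨⟨fun y => y.2.choose * e, fun t y => ?_⟩, ?_⟩
    · rw [key (t • y) (t * y.2.choose)]
      · exact mul_assoc _ _ _
      · rw [mul_smul, y.2.choose_spec]; rfl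
    · change (_ * e) • x = x
      rw [key _ 1 (one_smul S x), one_mul, he.smul_eq]

theorem IsRegularIdempotent.map {M N : Type*} [MulAction S M] [MulAction S N] {x : M} {e : S}
    (he : IsRegularIdempotent x e) {y : N} (h : ∀ s t : S, s • x = t • x ↔ s • y = t • y) :
    IsRegularIdempotent y e where
  mul_self := he.mul_self
  smul_eq := by simpa using (h e 1).1 (by simpa using he.smul_eq)
  cancel s t hst := he.cancel s t ((h s t).2 hst)

theorem IsRegularIdempotent.smul_iff {M : Type*} [MulAction S M] {x : M} {e : S}
    (he : IsRegularIdempotent x e) (s t : S) : s • x = t • x ↔ s * e = t * e := by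
  refine ⟨he.cancel s t, fun h => ?_⟩
  rw [← he.smul_eq, ← mul_smul, ← mul_smul, h]

theorem IsRegularIdempotent.smul_smul_iff {M : Type*} [MulAction S M] {x : M} {e : S}
    (he : IsRegularIdempotent x e) (r s t : S) :
    s • r • x = t • r • x ↔ s • (r * e) = t • (r * e) := by
  simp only [← mul_smul, he.smul_iff, smul_eq_mul, mul_assoc]

theorem IsActRegular.of_smul_iff {M N : Type*} [MulAction S M] [MulAction S N] {x : M}
    (hx : IsActRegular S x) {y : N} (h : ∀ s t : S, s • x = t • x ↔ s • y = t • y) :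
    IsActRegular S y := by
  obtain ⟨e, he⟩ := (isActRegular_iff x).1 hx
  exact (isActRegular_iff y).2 ⟨e, he.map h⟩

theorem isActRegular_coe_iff {B : SubMulAction S S} (x : B) :
    IsActRegular S (x : S) ↔ IsActRegular S x := by
  have h (s t : S) : s • (x : S) = t • (x : S) ↔ s • x = t • x := by
    simp only [Subtype.ext_iff, SubMulAction.val_smul]
  exact ⟨fun hx => hx.of_smul_iff h, fun hx => hx.of_smul_iff fun s t => (h s t).symm⟩

theorem isActRegular_of_mem_maxRegularSubact {a : S} (ha : a ∈ maxRegularSubact S) :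
    IsActRegular S a := by
  obtain ⟨B, hB, haB⟩ := ha
  exact (isActRegular_coe_iff ⟨a, haB⟩).2 (hB _)

theorem isRegularAct_of_le_maxRegularSubact {B : SubMulAction S S}
    (hB : ∀ a ∈ B, a ∈ maxRegularSubact S) : IsRegularAct S B := fun a =>
  (isActRegular_coe_iff a).1 (isActRegular_of_mem_maxRegularSubact (hB a a.2))

theorem isRegularAct_maxRegularSubact : IsRegularAct S (maxRegularSubact S) :=
  isRegularAct_of_le_maxRegularSubact fun _ h => h

/-- Each `r * e` has the same congruence as `r • x`, so `Se` is itself regular and lies in `R`. -/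
theorem IsRegularAct.exists_idempotent {M : Type w} [MulAction S M] (hM : IsRegularAct S M)
    (x : M) : ∃ e ∈ maxRegularSubact S, IsRegularIdempotent x e := by
  obtain ⟨e, he⟩ := (isActRegular_iff x).1 (hM x)
  refine ⟨e, ⟨cyclicSubact S e, ?_, self_mem_cyclicSubact S e⟩, he⟩
  rintro ⟨_, r, rfl⟩
  exact (isActRegular_coe_iff _).1 ((hM (r • x)).of_smul_iff fun s t => he.smul_smul_iff r s t)

theorem exists_idempotent_of_mem_maxRegularSubact {a : S} (ha : a ∈ maxRegularSubact S) :
    ∃ e ∈ maxRegularSubact S, e * e = e ∧ e * a = a := by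
  obtain ⟨e, heR, he⟩ := isRegularAct_maxRegularSubact.exists_idempotent ⟨a, ha⟩
  exact ⟨e, heR, he.mul_self, congrArg Subtype.val he.smul_eq⟩

/-- An idempotent of `R` fixes `a`, so `a` itself lies in `Ra`, although `R` need not contain `1`.
-/
theorem range_mul_subset_iff (a b : maxRegularSubact S) :
    Set.range (fun t : maxRegularSubact S => t * a) ⊆
      Set.range (fun t : maxRegularSubact S => t * b) ↔ (a : S) ∈ cyclicSubact S (b : S) := by
  constructor
  · intro h
    obtain ⟨e, heR, -, hea⟩ := exists_idempotent_of_mem_maxRegularSubact a.2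
    obtain ⟨t, ht⟩ := h ⟨⟨e, heR⟩, rfl⟩
    exact ⟨t, (congrArg Subtype.val ht).trans hea⟩
  · rintro ⟨s, hs⟩ _ ⟨t, rfl⟩
    refine ⟨⟨s * t, (maxRegularSubact S).smul_mem s t.2⟩, Subtype.ext ?_⟩
    change s * t * (b : S) = t * a
    rw [← hs, smul_eq_mul, mul_left_comm, mul_assoc]

theorem isLinearlyOrderedSemigroup_maxRegularSubact_iff :
    IsLinearlyOrderedSemigroup (maxRegularSubact S) ↔
      ∀ a ∈ maxRegularSubact S, ∀ b ∈ maxRegularSubact S,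
        a ∈ cyclicSubact S b ∨ b ∈ cyclicSubact S a := by
  simp only [IsLinearlyOrderedSemigroup, range_mul_subset_iff, Subtype.forall]

end ActRegular

/-! ### The Mal'tsev operation on regular acts -/

section Maltsev

variable {S : Type u} [CommMonoid S] {M : Type w} [MulAction S M]

open Classical in
/-- The operation picking the endpoint of `x, y, z` whose other neighbour is harder to merge
with `y`. -/
noncomputable def maltsev (S : Type u) [CommMonoid S] {M : Type w} [MulAction S M]
    (x y z : M) : M :=
  if ∀ s : S, s • y = s • z → s • x = s • y then z else x

theorem maltsev_left (x z : M) : maltsev S x x z = z := by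
  simp [maltsev]

theorem maltsev_right (x z : M) : maltsev S x z z = x := by
  unfold maltsev
  split_ifs with h
  · simpa using (h 1 rfl).symm
  · rfl

/-- Of two comparable idempotents, the larger one acts as an identity on the smaller. -/
theorem IsRegularAct.exists_common_idempotent (hM : IsRegularAct S M)
    (hR : ∀ a ∈ maxRegularSubact S, ∀ b ∈ maxRegularSubact S,
      a ∈ cyclicSubact S b ∨ b ∈ cyclicSubact S a) (x y z : M) :
    ∃ e ∈ maxRegularSubact S, e • x = x ∧ e • y = y ∧ e • z = z := by
  have join (e f : S) (he : e ∈ maxRegularSubact S) (hf : f ∈ maxRegularSubact S)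
      (hee : e * e = e) (hff : f * f = f) :
      ∃ g ∈ maxRegularSubact S, g * g = g ∧ g * e = e ∧ g * f = f := by
    rcases hR e he f hf with ⟨s, hs⟩ | ⟨s, hs⟩
    · refine ⟨f, hf, hff, ?_, hff⟩
      rw [← hs, smul_eq_mul, mul_left_comm, hff]
    · refine ⟨e, he, hee, hee, ?_⟩
      rw [← hs, smul_eq_mul, mul_left_comm, hee]
  obtain ⟨e, he, hx⟩ := hM.exists_idempotent x
  obtain ⟨f, hf, hy⟩ := hM.exists_idempotent y
  obtain ⟨g, hg, hz⟩ := hM.exists_idempotent z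
  obtain ⟨p, hp, hpp, hpe, hpf⟩ := join e f he hf hx.mul_self hy.mul_self
  obtain ⟨q, hq, -, hqp, hqg⟩ := join p g hp hg hpp hz.mul_self
  refine ⟨q, hq, ?_, ?_, ?_⟩
  · rw [← hx.smul_eq, ← hpe, ← mul_smul, ← mul_assoc, hqp]
  · rw [← hy.smul_eq, ← hpf, ← mul_smul, ← mul_assoc, hqp]
  · rw [← hz.smul_eq, ← mul_smul, hqg]

theorem IsRegularAct.maltsev_smul (hM : IsRegularAct S M)
    (hR : ∀ a ∈ maxRegularSubact S, ∀ b ∈ maxRegularSubact S,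
      a ∈ cyclicSubact S b ∨ b ∈ cyclicSubact S a) (t : S) (x y z : M) :
    maltsev S (t • x) (t • y) (t • z) = t • maltsev S x y z := by
  by_cases h : ∀ s : S, s • y = s • z → s • x = s • y
  · have h' : ∀ s : S, s • t • y = s • t • z → s • t • x = s • t • y := by
      simpa only [← mul_smul] using fun s => h (s * t)
    rw [maltsev, maltsev, if_pos h, if_pos h']
  rw [maltsev, maltsev, if_neg h]
  split_ifs with h'
  · push Not at h
    obtain ⟨r, hyz, hxy⟩ := h
    obtain ⟨e, he, hx, hy, hz⟩ := hM.exists_common_idempotent hR x y z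
    have fix (a q b : S) (hab : q * (b * e) = a * e) (w : M) (hw : e • w = w) :
        a • w = q • b • w := by
      rw [← hw, ← mul_smul, ← hab, mul_smul, mul_smul]
    rcases hR (t * e) ((maxRegularSubact S).smul_mem t he)
      (r * e) ((maxRegularSubact S).smul_mem r he) with ⟨q, hq⟩ | ⟨q, hq⟩
    · have htyz : t • y = t • z := by
        rw [fix t q r hq y hy, fix t q r hq z hz, hyz]
      have := h' 1 (by rw [htyz])
      rw [one_smul, one_smul] at this
      rw [this, htyz]
    · refine absurd ?_ hxy
      rw [fix r q t hq x hx, fix r q t hq y hy]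
      refine h' q ?_
      rw [← fix r q t hq y hy, ← fix r q t hq z hz, hyz]
  · rfl

end Maltsev

/-! ### Mal'tsev operations and primitive formulas -/

section Preservation

variable {L : FirstOrder.Language.{u, v}} {M : Type w} [L.Structure M] {α : Type} {k : ℕ}

/-- A ternary operation commutes with all function symbols. -/
def CommutesWithFunctions (L : FirstOrder.Language.{u, v}) [L.Structure M] (m : M → M → M → M) :
    Prop :=
  ∀ (n : ℕ) (f : L.Functions n) (x y z : Fin n → M),
    Structure.funMap f (fun i => m (x i) (y i) (z i)) =
      m (Structure.funMap f x) (Structure.funMap f y) (Structure.funMap f z)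

theorem CommutesWithFunctions.realize_term {m : M → M → M → M} (hm : CommutesWithFunctions L m)
    {β : Type} (t : L.Term β) (x y z : β → M) :
    t.realize (fun i => m (x i) (y i) (z i)) = m (t.realize x) (t.realize y) (t.realize z) := by
  induction t with
  | var i => rfl
  | func f ts ih =>
    simp only [Term.realize_func, ih]
    exact hm _ f _ _ _

theorem CommutesWithFunctions.realize_isAtomicConj [L.IsAlgebraic] {m : M → M → M → M}
    (hm : CommutesWithFunctions L m) {ψ : L.BoundedFormula α k} (hψ : IsAtomicConj ψ)
    {x y z : α → M} {x' y' z' : Fin k → M} (hx : ψ.Realize x x') (hy : ψ.Realize y y')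
    (hz : ψ.Realize z z') :
    ψ.Realize (fun i => m (x i) (y i) (z i)) (fun i => m (x' i) (y' i) (z' i)) := by
  induction hψ with
  | atomic h =>
    cases h with
    | equal t₁ t₂ =>
      simp only [BoundedFormula.realize_bdEqual] at hx hy hz ⊢
      have sum_elim : Sum.elim (fun i => m (x i) (y i) (z i)) (fun i => m (x' i) (y' i) (z' i)) =
          fun i => m (Sum.elim x x' i) (Sum.elim y y' i) (Sum.elim z z' i) := by
        ext (i | i) <;> rfl
      rw [sum_elim, hm.realize_term, hm.realize_term, hx, hy, hz]
    | rel R _ => exact isEmptyElim R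
  | inf _ _ ih₁ ih₂ =>
    rw [BoundedFormula.realize_inf] at hx hy hz ⊢
    exact ⟨ih₁ hx.1 hy.1 hz.1, ih₂ hx.2 hy.2 hz.2⟩

theorem CommutesWithFunctions.realize_isPrimitiveFormula [L.IsAlgebraic] {m : M → M → M → M}
    (hm : CommutesWithFunctions L m) {Φ : L.Formula α} (hΦ : IsPrimitiveFormula Φ)
    {x y z : α → M} (hx : Φ.Realize x) (hy : Φ.Realize y) (hz : Φ.Realize z) :
    Φ.Realize (fun i => m (x i) (y i) (z i)) := by
  obtain ⟨k, ψ, hψ, rfl⟩ := hΦ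
  rw [BoundedFormula.realize_exs] at *
  obtain ⟨x', hx⟩ := hx
  obtain ⟨y', hy⟩ := hy
  obtain ⟨z', hz⟩ := hz
  exact ⟨_, hm.realize_isAtomicConj hψ hx hy hz⟩

theorem CommutesWithFunctions.solutionSet_subset [L.IsAlgebraic] {m : M → M → M → M}
    (hm : CommutesWithFunctions L m) (hleft : ∀ x z, m x x z = z) (hright : ∀ x z, m x z z = x)
    {p q : ℕ} {Φ : L.Formula (Fin p ⊕ Fin q)} (hΦ : IsPrimitiveFormula Φ) {a b : Fin q → M}
    {c : Fin p → M} (hca : c ∈ solutionSet Φ a) (hcb : c ∈ solutionSet Φ b) :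
    solutionSet Φ a ⊆ solutionSet Φ b := by
  intro d hd
  -- Applying `m` to `(d, a)`, `(c, a)`, `(c, b)` gives `(d, b)`.
  have h : Φ.Realize _ := hm.realize_isPrimitiveFormula hΦ hd hca hcb
  have sum_elim : (fun i => m (Sum.elim d a i) (Sum.elim c a i) (Sum.elim c b i)) =
      Sum.elim d b := by
    ext (i | i) <;> simp [hleft, hright]
  rwa [sum_elim] at h

theorem CommutesWithFunctions.solutionSet_eq_or_disjoint [L.IsAlgebraic] {m : M → M → M → M}
    (hm : CommutesWithFunctions L m) (hleft : ∀ x z, m x x z = z) (hright : ∀ x z, m x z z = x)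
    {p q : ℕ} {Φ : L.Formula (Fin p ⊕ Fin q)} (hΦ : IsPrimitiveFormula Φ) (a b : Fin q → M) :
    solutionSet Φ a = solutionSet Φ b ∨ solutionSet Φ a ∩ solutionSet Φ b = ∅ := by
  rw [or_iff_not_imp_right, ← Ne, ← Set.nonempty_iff_ne_empty]
  rintro ⟨c, hca, hcb⟩
  exact (hm.solutionSet_subset hleft hright hΦ hca hcb).antisymm
    (hm.solutionSet_subset hleft hright hΦ hcb hca)

end Preservation

instance actLanguage_isAlgebraic (S : Type u) : (actLanguage S).IsAlgebraic :=
  fun _ => inferInstanceAs (IsEmpty Empty)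

/-! ### Primitive normality forces comparability -/

section Zigzag

variable {S : Type u}

/-- The `L_S`-structure of an act. -/
@[reducible]
def actStructure (S : Type u) [CommMonoid S] (M : Type w) [MulAction S M] :
    (actLanguage S).Structure M where
  funMap := fun {n} (f : ActFunction S n) =>
    match n, f with
    | _, ActFunction.act s => fun x => s • x 0
  RelMap := fun r => Empty.elim r

/-- The formula `∃ u, x = a u ∧ y = b u`. -/
def commonSourceFormula (a b : S) : (actLanguage S).Formula (Fin 1 ⊕ Fin 1) :=
  BoundedFormula.exs (n := 1)
    (Term.bdEqual (Term.var (Sum.inl (Sum.inl 0)))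
        (Term.func (ActFunction.act a : (actLanguage S).Functions 1)
          fun _ => Term.var (Sum.inr 0)) ⊓
      Term.bdEqual (Term.var (Sum.inl (Sum.inr 0)))
        (Term.func (ActFunction.act b : (actLanguage S).Functions 1)
          fun _ => Term.var (Sum.inr 0)))

theorem isPrimitiveFormula_commonSourceFormula (a b : S) :
    IsPrimitiveFormula (commonSourceFormula a b) :=
  ⟨1, _, .inf (.atomic (.equal _ _)) (.atomic (.equal _ _)), rfl⟩

variable [CommMonoid S]

theorem mem_solutionSet_commonSourceFormula {M : Type w} [MulAction S M] (a b : S)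
    (x y : Fin 1 → M) :
    letI := actStructure S M
    x ∈ solutionSet (commonSourceFormula a b) y ↔ ∃ u : M, x 0 = a • u ∧ y 0 = b • u := by
  let := actStructure S M
  simp only [solutionSet, commonSourceFormula, Set.mem_ofPred_eq, BoundedFormula.realize_exs,
    BoundedFormula.realize_inf, BoundedFormula.realize_bdEqual, Term.realize_var,
    Sum.elim_inl, Sum.elim_inr]
  exact ⟨fun ⟨u, h⟩ => ⟨u 0, h⟩, fun ⟨u, h⟩ => ⟨fun _ => u, h⟩⟩

/-- The solution sets for `b • u₁` and `b • u₃` share `a • u₂`, hence are equal, and the first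
contains `a • u₁`. -/
theorem IsPrimitiveNormalClass.exists_of_zigzag
    (h : IsPrimitiveNormalClass (regularActs S)) {M : Type u} [MulAction S M]
    (hM : IsRegularAct S M) {a b : S} {u₁ u₂ u₃ : M} (hb : b • u₁ = b • u₂)
    (ha : a • u₂ = a • u₃) : ∃ u : M, a • u = a • u₁ ∧ b • u = b • u₃ := by
  let := actStructure S M
  have : Nonempty M := ⟨u₁⟩
  have : M ⊨ theoryOfClass (regularActs S) :=
    ⟨fun σ hσ => hσ ⟨M, inferInstance⟩ ⟨⟨u₁⟩, inferInstance, fun _ _ => rfl, hM⟩⟩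
  have mem (x y : Fin 1 → M) := mem_solutionSet_commonSourceFormula a b x y
  rcases h (Theory.ModelType.of _ M) 1 1 _ (isPrimitiveFormula_commonSourceFormula a b)
    (fun _ => b • u₁) (fun _ => b • u₃) with heq | hdisj
  · have h₁ : (fun _ => a • u₁) ∈ solutionSet (commonSourceFormula a b) (fun _ => b • u₁) :=
      (mem _ _).2 ⟨u₁, rfl, rfl⟩
    obtain ⟨u, hu, hu'⟩ := (mem _ _).1 (heq ▸ h₁)
    exact ⟨u, hu.symm, hu'.symm⟩
  · have h₂ : (fun _ => a • u₂) ∈ solutionSet (commonSourceFormula a b) (fun _ => b • u₁) :=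
      (mem _ _).2 ⟨u₂, rfl, hb⟩
    have h₃ : (fun _ => a • u₂) ∈ solutionSet (commonSourceFormula a b) (fun _ => b • u₃) :=
      (mem _ _).2 ⟨u₃, ha, rfl⟩
    exact (Set.eq_empty_iff_forall_notMem.1 hdisj _ ⟨h₂, h₃⟩).elim

theorem IsPrimitiveNormalClass.idempotent_comparable
    (h : IsPrimitiveNormalClass (regularActs S)) {e f : S} (he : e ∈ maxRegularSubact S)
    (hf : f ∈ maxRegularSubact S) (hee : e * e = e) (hff : f * f = f) :
    e ∈ cyclicSubact S f ∨ f ∈ cyclicSubact S e := by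
  have hreg : IsRegularAct S ↥(cyclicSubact S e ⊔ cyclicSubact S f) := by
    refine isRegularAct_of_le_maxRegularSubact ?_
    rintro _ (⟨s, rfl⟩ | ⟨s, rfl⟩)
    · exact (maxRegularSubact S).smul_mem s he
    · exact (maxRegularSubact S).smul_mem s hf
  -- The zigzag `e, e * f, f` yields `u` with `e * u = e` and `f * u = f`; whichever of `Se`, `Sf`
  -- contains `u` contains both.
  obtain ⟨⟨u, hu⟩, hue, huf⟩ := h.exists_of_zigzag hreg (a := e) (b := f)
    (u₁ := ⟨e, Or.inl (self_mem_cyclicSubact S e)⟩) (u₂ := ⟨e * f, Or.inl ⟨f, mul_comm f e⟩⟩)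
    (u₃ := ⟨f, Or.inr (self_mem_cyclicSubact S f)⟩)
    (Subtype.ext (by
      simp only [SubMulAction.val_smul, smul_eq_mul]; rw [mul_left_comm, hff, mul_comm]))
    (Subtype.ext (by
      simp only [SubMulAction.val_smul, smul_eq_mul]; rw [← mul_assoc, hee]))
  replace hue : e * u = e * e := congrArg Subtype.val hue
  replace huf : f * u = f * f := congrArg Subtype.val huf
  rcases hu with ⟨s, rfl⟩ | ⟨s, rfl⟩
  · right
    exact ⟨f * s, (mul_assoc f s e).trans (huf.trans hff)⟩
  · left
    exact ⟨e * s, (mul_assoc e s f).trans (hue.trans hee)⟩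

/-- Three copies of the act `B`: the first one, whose elements carry the flag `(True, False)`, is
glued to the middle one, with flag `(False, False)`, along the subact `P`; the third one, with flag
`(False, True)`, is glued to it along the subact `Q`. -/
structure GluedCopies (B P Q : SubMulAction S S) where
  val : S
  first : Prop
  third : Prop
  mem : val ∈ B
  not_both : ¬ (first ∧ third)
  first_notMem : first → val ∉ P
  third_notMem : third → val ∉ Q

namespace GluedCopies

variable {B P Q : SubMulAction S S}

@[ext]
theorem ext' {x y : GluedCopies B P Q} (h : x.val = y.val) (h₁ : x.first ↔ y.first)
    (h₂ : x.third ↔ y.third) : x = y := by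
  cases x; cases y
  obtain rfl : _ = _ := h
  obtain rfl := propext h₁
  obtain rfl := propext h₂
  rfl

instance : MulAction S (GluedCopies B P Q) where
  smul t x :=
    { val := t * x.val
      first := x.first ∧ t * x.val ∉ P
      third := x.third ∧ t * x.val ∉ Q
      mem := B.smul_mem t x.mem
      not_both := fun h => x.not_both ⟨h.1.1, h.2.1⟩
      first_notMem := fun h => h.2
      third_notMem := fun h => h.2 }
  one_smul x := ext' (one_mul x.val)
    (by
      change x.first ∧ 1 * x.val ∉ P ↔ _
      rw [one_mul]
      exact ⟨And.left, fun h => ⟨h, x.first_notMem h⟩⟩)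
    (by
      change x.third ∧ 1 * x.val ∉ Q ↔ _
      rw [one_mul]
      exact ⟨And.left, fun h => ⟨h, x.third_notMem h⟩⟩)
  mul_smul s t x := ext' (mul_assoc s t x.val)
    (by
      change x.first ∧ s * t * x.val ∉ P ↔ (x.first ∧ t * x.val ∉ P) ∧ s * (t * x.val) ∉ P
      rw [mul_assoc]
      exact ⟨fun h => ⟨⟨h.1, fun h' => h.2 (P.smul_mem s h')⟩, h.2⟩, fun h => ⟨h.1.1, h.2⟩⟩)
    (by
      change x.third ∧ s * t * x.val ∉ Q ↔ (x.third ∧ t * x.val ∉ Q) ∧ s * (t * x.val) ∉ Q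
      rw [mul_assoc]
      exact ⟨fun h => ⟨⟨h.1, fun h' => h.2 (Q.smul_mem s h')⟩, h.2⟩, fun h => ⟨h.1.1, h.2⟩⟩)

theorem val_smul (t : S) (x : GluedCopies B P Q) : (t • x).val = t * x.val := rfl

theorem first_smul (t : S) (x : GluedCopies B P Q) :
    (t • x).first ↔ x.first ∧ t * x.val ∉ P := Iff.rfl

theorem third_smul (t : S) (x : GluedCopies B P Q) :
    (t • x).third ↔ x.third ∧ t * x.val ∉ Q := Iff.rfl

/-- The flags of `s • x` depend only on `x` and `s * x.val`, so gluing leaves congruences, and hence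
regularity, unchanged. -/
theorem smul_eq_smul_iff (s t : S) (x : GluedCopies B P Q) :
    s • x.val = t • x.val ↔ s • x = t • x := by
  refine ⟨fun h => ?_, congrArg val⟩
  rw [smul_eq_mul, smul_eq_mul] at h
  ext <;> simp only [val_smul, first_smul, third_smul, h]

theorem isRegularAct (hB : ∀ a ∈ B, a ∈ maxRegularSubact S) :
    IsRegularAct S (GluedCopies B P Q) := fun x =>
  (isActRegular_of_mem_maxRegularSubact (hB _ x.mem)).of_smul_iff fun s t =>
    smul_eq_smul_iff s t x

end GluedCopies

theorem IsPrimitiveNormalClass.comparable_of_mul_eq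
    (h : IsPrimitiveNormalClass (regularActs S)) {e a b : S} (he : e ∈ maxRegularSubact S)
    (hea : e * a = a) (heb : e * b = b) : a ∈ cyclicSubact S b ∨ b ∈ cyclicSubact S a := by
  by_contra! hab
  obtain ⟨hab, hba⟩ := hab
  rw [mul_comm] at hea heb
  have hreg : IsRegularAct S
      (GluedCopies (cyclicSubact S e) (cyclicSubact S b) (cyclicSubact S a)) := by
    refine GluedCopies.isRegularAct ?_
    rintro _ ⟨s, rfl⟩
    exact (maxRegularSubact S).smul_mem s he
  have hself := self_mem_cyclicSubact S e
  have heP : e ∉ cyclicSubact S b := fun hmem => hab (hea ▸ (cyclicSubact S b).smul_mem a hmem)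
  have heQ : e ∉ cyclicSubact S a := fun hmem => hba (heb ▸ (cyclicSubact S a).smul_mem b hmem)
  have hbP : b * e ∈ cyclicSubact S b := heb.symm ▸ self_mem_cyclicSubact S b
  have haQ : a * e ∈ cyclicSubact S a := hea.symm ▸ self_mem_cyclicSubact S a
  -- The three copies of `e`: `b` merges the first two, `a` the last two.
  obtain ⟨u, hu, hu'⟩ := h.exists_of_zigzag hreg (a := a) (b := b)
    (u₁ := ⟨e, True, False, hself, And.right, fun _ => heP, False.elim⟩)
    (u₂ := ⟨e, False, False, hself, And.left, False.elim, False.elim⟩)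
    (u₃ := ⟨e, False, True, hself, And.left, False.elim, fun _ => heQ⟩)
    (by ext <;> simp [GluedCopies.val_smul, GluedCopies.first_smul, GluedCopies.third_smul, hbP])
    (by ext <;> simp [GluedCopies.val_smul, GluedCopies.first_smul, GluedCopies.third_smul, haQ])
  -- As `a ∉ Sb` and `b ∉ Sa`, `u` would lie in both outer copies.
  have hfirst : (a • u).first := hu ▸ ⟨trivial, fun hmem => hab (hea ▸ hmem)⟩
  have hthird : (b • u).third := hu' ▸ ⟨trivial, fun hmem => hba (heb ▸ hmem)⟩
  exact u.not_both ⟨hfirst.1, hthird.1⟩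

end Zigzag

theorem mainTheorem1 {S : Type*} [CommMonoid S] (hax : IsAxiomatizable (regularActs S)) :
    IsPrimitiveNormalClass (regularActs S) ↔
      IsLinearlyOrderedSemigroup (maxRegularSubact S) := by
  rw [isLinearlyOrderedSemigroup_maxRegularSubact_iff]
  constructor
  · intro h a ha b hb
    obtain ⟨e, he, hee, hea⟩ := exists_idempotent_of_mem_maxRegularSubact ha
    obtain ⟨f, hf, hff, hfb⟩ := exists_idempotent_of_mem_maxRegularSubact hb
    -- The larger idempotent fixes both `a` and `b`.
    rcases h.idempotent_comparable he hf hee hff with ⟨s, hs⟩ | ⟨s, hs⟩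
    · refine h.comparable_of_mul_eq hf ?_ hfb
      rw [← hea, ← hs, smul_eq_mul, ← mul_assoc, mul_left_comm, hff]
    · refine h.comparable_of_mul_eq he hea ?_
      rw [← hfb, ← hs, smul_eq_mul, ← mul_assoc, mul_left_comm, hee]
  · intro hR M p q Φ hΦ a b
    obtain ⟨T, hT⟩ := hax
    have hMT : (M : Type _) ⊨ T :=
      ⟨fun σ hσ => M.is_model.realize_of_mem σ
        fun N hN => ((hT N).1 hN).2.realize_of_mem σ hσ⟩
    obtain ⟨-, hact, hfun, hreg⟩ := (hT ⟨M, M.struc⟩).2 ⟨M.nonempty', hMT⟩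
    have hcomm : CommutesWithFunctions (actLanguage S) (maltsev S (M := M)) := by
      rintro _ ⟨s⟩ x y z
      exact (hfun s _).trans ((hreg.maltsev_smul hR s (x 0) (y 0) (z 0)).symm.trans
        (congr (congr (congrArg _ (hfun s x).symm) (hfun s y).symm) (hfun s z).symm))
    exact hcomm.solutionSet_eq_or_disjoint maltsev_left maltsev_right hΦ a b
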